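/- Let $T$ be a complete first-order theory in a one-sorted language $L$. A monster model of $T$ is a model $\mathbb{M}$ that is $\kappa$-saturated and strongly $\kappa$-homogeneous for some uncountable cardinal $\kappa > |L|$. "Definable" means definable with parameters; a definable set in a model $M$ is a subset of some $M^n$ (interpretable sets are not included). A topology on $\mathbb{M}$ is definable if there is a definable family $\{B_a\}_{a \in D}$ of subsets of $\mathbb{M}$ which is a basis of open sets for it. The theory $T$ is t-minimal if some monster model $\mathbb{M}$ of $T$ carries a Hausdorff definable topology such that a definable set $X \subseteq \mathbb{M}$ has non-empty interior if and only if $X$ is infinite. Suppose that $T$ is t-minimal, let $M$ be a model of $T$, and let $(K,+,\cdot)$ be a definable field in $M$, that is, a field whose underlying set $K \subseteq M^n$ and whose graphs of addition and multiplication are definable in $M$. Then $K$ is perfect. -/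

import Mathlib

open FirstOrder FirstOrder.Language Cardinal

universe u v w w'

namespace TMin

section Monster

variable (L : FirstOrder.Language.{u, v}) (N : Type w) [L.Structure N]

/-- `N` is `κ`-saturated: every partial type in finitely many variables over a set of fewer than
`κ` parameters which is finitely satisfiable in `N` is realized in `N`. -/
def IsSaturated (κ : Cardinal.{w}) : Prop :=
  ∀ (A : Set N), #A < κ → ∀ (n : ℕ) (p : Set (L[[A]].Formula (Fin n))),
    (∀ p₀ ⊆ p, p₀.Finite → ∃ b : Fin n → N, ∀ φ ∈ p₀, φ.Realize b) →
      ∃ b : Fin n → N, ∀ φ ∈ p, φ.Realize b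

/-- `N` is strongly `κ`-homogeneous: every partial elementary map of `N` whose domain has fewer
than `κ` elements extends to an automorphism of `N`. -/
def IsStronglyHomogeneous (κ : Cardinal.{w}) : Prop :=
  ∀ (A : Set N), #A < κ → ∀ f : A → N,
    (∀ φ : L.Formula A, φ.Realize (fun a : A => (a : N)) ↔ φ.Realize f) →
      ∃ σ : N ≃[L] N, ∀ a : A, σ a = f a

/-- `N` is a monster model (of its complete theory): it is `κ`-saturated and strongly
`κ`-homogeneous for some uncountable cardinal `κ` larger than the cardinality of the language. -/
def IsMonster : Prop :=
  ∃ κ : Cardinal.{w}, ℵ₀ < κ ∧ Cardinal.lift.{w} L.card < Cardinal.lift.{max u v} κ ∧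
    IsSaturated L N κ ∧ IsStronglyHomogeneous L N κ

/-- A topology on `N` is definable if it has a basis of open sets of the form `{B_a : a ∈ D}` for
some definable family `(B_a)_{a ∈ D}`. Here `D ⊆ N ^ m` is definable, and the family is given by a
definable set `B ⊆ N ^ m × N` with `B_a = {x | (a, x) ∈ B}`. Parameters are allowed. -/
def IsDefinableTopology (τ : TopologicalSpace N) : Prop :=
  ∃ (m : ℕ) (D : Set (Fin m → N)) (B : Set (Fin m ⊕ Unit → N)),
    (Set.univ : Set N).Definable L D ∧ (Set.univ : Set N).Definable L B ∧
      @TopologicalSpace.IsTopologicalBasis N τ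
        {U | ∃ a ∈ D, U = {x : N | Sum.elim a (fun _ => x) ∈ B}}

/-- A Hausdorff definable topology on `N` for which a definable subset of `N` (with parameters) has
non-empty interior if and only if it is infinite. -/
structure IsTMinimalTopology (τ : TopologicalSpace N) : Prop where
  t2 : @T2Space N τ
  definable : IsDefinableTopology L N τ
  interior_nonempty_iff : ∀ X : Set N, (Set.univ : Set N).Definable₁ L X →
    ((@interior N τ X).Nonempty ↔ X.Infinite)

end Monster

/-- The theory `T` (meant to be complete) is t-minimal: it has a monster model which carries a
t-minimal definable topology. -/
def IsTMinimal {L : FirstOrder.Language.{u, v}} (T : L.Theory) : Prop :=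
  ∃ (N : Type w) (_ : L.Structure N), Nonempty N ∧ N ⊨ T ∧ IsMonster L N ∧
    ∃ τ : TopologicalSpace N, IsTMinimalTopology L N τ

/-- A field whose underlying set `K` is a subset of `M ^ n` is a definable field in the structure
`M` if `K` and the graphs of addition and multiplication are definable (with parameters). -/
structure IsDefinableField (L : FirstOrder.Language.{u, v}) {M : Type w'} [L.Structure M] {n : ℕ}
    (K : Set (Fin n → M)) [Field K] : Prop where
  carrier : (Set.univ : Set M).Definable L K
  add : (Set.univ : Set M).Definable L
    {t : Fin n ⊕ Fin n ⊕ Fin n → M | ∃ x y : K,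
      t = Sum.elim (x : Fin n → M) (Sum.elim (y : Fin n → M) ((x + y : K) : Fin n → M))}
  mul : (Set.univ : Set M).Definable L
    {t : Fin n ⊕ Fin n ⊕ Fin n → M | ∃ x y : K,
      t = Sum.elim (x : Fin n → M) (Sum.elim (y : Fin n → M) ((x * y : K) : Fin n → M))}

end TMin


/-!
If `K` is not perfect, of characteristic `p`, and `t ∈ K` is not a `p`-th power, then
`(x, y) ↦ x ^ p + t * y ^ p` is a definable injection `K × K → K`. Such an injection can be moved to
the monster model `N`, where an infinite definable `K ⊆ N ^ n` is related, with finite fibres on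
both sides, to an infinite definable subset of `N`. Iterating the injection gives a definable
finite-to-finite relation between `N ^ (n + 1)` and `N ^ n` whose domain has non-empty interior.
This is excluded by induction on the dimension, as follows.

A definable subset of `N ^ m` with empty interior is thin: it is covered by definable sets `C j`,
`j < m`, that are finite on the lines in direction `j`. By uniform finiteness a thin set contains no
large finite grid, so finite unions of thin sets have empty interior. Moreover a point of `C j` is
determined by its other coordinates up to finitely many choices, so a finite-to-finite relation with
thin codomain lowers the dimension by one more. Let now `R` be a definable finite-to-finite relation
between `N ^ (m + 1)` and `N ^ m` whose domain has interior. By the induction hypothesis, for `u`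
generic in the domain and `b` related to `u`, the image of each slice `{u' | u' i = u i}` of the
domain is a neighbourhood of `b`. The set `A b` of the values `a` for which the image of some slice
`{u' | u' i = a}` is a neighbourhood of `b` can only grow near `b`, and it has boundedly many
elements, so it is constant on an open set. The points of this open set are then related to points
of a fixed finite grid, although there are infinitely many of them.
-/

namespace TMin

/-- An identification of `Γ` with a finite power of `N`, so that products of powers of `N` can be
used as powers of `N` without reindexing. -/
class Coords (N : Type w) (Γ : Type w) where
  idx : Type
  [finite_idx : Finite idx]
  equiv : Γ ≃ (idx → N)

namespace Coords

variable (N : Type w)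

attribute [instance] finite_idx

instance self : Coords N N := ⟨Unit, (Equiv.funUnique Unit N).symm⟩

instance pi {β : Type} [Finite β] : Coords N (β → N) := ⟨β, Equiv.refl _⟩

instance prod {Γ Δ : Type w} [Coords N Γ] [Coords N Δ] : Coords N (Γ × Δ) :=
  ⟨idx N Γ ⊕ idx N Δ, (Equiv.prodCongr equiv equiv).trans (Equiv.sumArrowEquivProdArrow _ _ _).symm⟩

end Coords

section Definability

variable (L : FirstOrder.Language.{u, v}) (N : Type w) [L.Structure N]
  {Γ Δ Θ : Type w} [Coords N Γ] [Coords N Δ] [Coords N Θ]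

/-- A predicate on a finite power of `N` that is definable with parameters. -/
@[fun_prop]
def IsDefinablePred (P : Γ → Prop) : Prop :=
  (Set.univ : Set N).Definable L {v : Coords.idx N Γ → N | P (Coords.equiv.symm v)}

/-- A map between finite powers of `N` whose graph is definable with parameters. -/
@[fun_prop]
def IsDefinableMap (f : Γ → Δ) : Prop :=
  (Set.univ : Set N).DefinableMap L fun v : Coords.idx N Γ → N =>
    Coords.equiv (f (Coords.equiv.symm v))

/-- A subset of a finite power of `N` that is definable with parameters. -/
def IsDefinable (S : Set Γ) : Prop := IsDefinablePred L N fun g => g ∈ S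

variable {L N}

namespace IsDefinableMap

@[fun_prop]
theorem id : IsDefinableMap L N fun g : Γ => g := fun i => by
  simpa only [Equiv.apply_symm_apply] using Set.DefinableFun.proj L

@[fun_prop]
theorem const (d : Δ) : IsDefinableMap L N fun _ : Γ => d := fun _ =>
  L.definableFun_const _ (Set.mem_univ _)

@[fun_prop]
theorem comp {f : Δ → Θ} {g : Γ → Δ} (hf : IsDefinableMap L N f) (hg : IsDefinableMap L N g) :
    IsDefinableMap L N fun x => f (g x) := fun i => by
  simpa only [Function.comp_def, Equiv.symm_apply_apply] using Set.DefinableFun.comp hg (hf i)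

@[fun_prop]
theorem fst {f : Γ → Δ × Θ} (hf : IsDefinableMap L N f) : IsDefinableMap L N fun x => (f x).1 :=
  fun i => hf (Sum.inl i)

@[fun_prop]
theorem snd {f : Γ → Δ × Θ} (hf : IsDefinableMap L N f) : IsDefinableMap L N fun x => (f x).2 :=
  fun i => hf (Sum.inr i)

@[fun_prop]
theorem prodMk {f : Γ → Δ} {g : Γ → Θ} (hf : IsDefinableMap L N f) (hg : IsDefinableMap L N g) :
    IsDefinableMap L N fun x => (f x, g x) := by
  rintro (i | i)
  · exact hf i
  · exact hg i

@[fun_prop]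
theorem pi {β : Type} [Finite β] {f : Γ → β → N} (hf : ∀ i, IsDefinableMap L N fun g => f g i) :
    IsDefinableMap L N f := fun i => hf i ()

@[fun_prop]
theorem apply {β : Type} [Finite β] (i : β) : IsDefinableMap L N fun v : β → N => v i := fun _ =>
  Set.DefinableFun.proj L

@[fun_prop]
theorem tail {m : ℕ} {f : Γ → Fin (m + 1) → N} (hf : IsDefinableMap L N f) :
    IsDefinableMap L N fun g => Fin.tail (f g) :=
  pi fun i => comp (apply i.succ) hf

@[fun_prop]
theorem removeNth {m : ℕ} (j : Fin (m + 1)) {f : Γ → Fin (m + 1) → N}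
    (hf : IsDefinableMap L N f) : IsDefinableMap L N fun g => j.removeNth (f g) :=
  pi fun i => comp (apply (j.succAbove i)) hf

@[fun_prop]
theorem insertNth {m : ℕ} (j : Fin (m + 1)) {t : Γ → N} {f : Γ → Fin m → N}
    (ht : IsDefinableMap L N t) (hf : IsDefinableMap L N f) :
    IsDefinableMap L N fun g => (j.insertNth (t g) (f g) : Fin (m + 1) → N) := by
  refine pi (j.forall_iff_succAbove.2 ⟨?_, fun i => ?_⟩)
  · simpa only [Fin.insertNth_apply_same] using ht
  · simpa only [Fin.insertNth_apply_succAbove] using comp (apply i) hf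

@[fun_prop]
theorem cons {m : ℕ} {t : Γ → N} {f : Γ → Fin m → N} (ht : IsDefinableMap L N t)
    (hf : IsDefinableMap L N f) :
    IsDefinableMap L N fun g => (Fin.cons (t g) (f g) : Fin (m + 1) → N) := by
  simpa only [Fin.insertNth_zero'] using insertNth 0 ht hf

@[fun_prop]
theorem update {m : ℕ} {f : Γ → Fin m → N} {t : Γ → N} (j : Fin m)
    (hf : IsDefinableMap L N f) (ht : IsDefinableMap L N t) :
    IsDefinableMap L N fun g => Function.update (f g) j (t g) := by
  refine pi fun i => ?_
  obtain rfl | hij := eq_or_ne i j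
  · simpa only [Function.update_self] using ht
  · simpa only [Function.update_of_ne hij] using comp (apply i) hf

end IsDefinableMap

namespace IsDefinablePred

theorem comp {P : Δ → Prop} (hP : IsDefinablePred L N P) {f : Γ → Δ} (hf : IsDefinableMap L N f) :
    IsDefinablePred L N fun g => P (f g) := by
  simpa only [IsDefinablePred, Set.preimage_ofPred_eq, Equiv.symm_apply_apply]
    using! Set.Definable.preimage_map hf hP

theorem congr {P Q : Γ → Prop} (hP : IsDefinablePred L N P) (h : ∀ g, Q g ↔ P g) :
    IsDefinablePred L N Q := by
  rwa [show Q = P from funext fun g => propext (h g)]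

@[fun_prop]
theorem not {P : Γ → Prop} (hP : IsDefinablePred L N P) : IsDefinablePred L N fun g => ¬ P g :=
  Set.Definable.compl hP

@[fun_prop]
theorem and {P Q : Γ → Prop} (hP : IsDefinablePred L N P) (hQ : IsDefinablePred L N Q) :
    IsDefinablePred L N fun g => P g ∧ Q g :=
  Set.Definable.inter hP hQ

@[fun_prop]
theorem imp {P Q : Γ → Prop} (hP : IsDefinablePred L N P) (hQ : IsDefinablePred L N Q) :
    IsDefinablePred L N fun g => P g → Q g :=
  IsDefinablePred.congr (P := fun g => ¬ P g ∨ Q g)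
    (Set.Definable.union (Set.Definable.compl hP) hQ) fun _ => imp_iff_not_or

@[fun_prop]
theorem ex {P : Γ → Δ → Prop} (hP : IsDefinablePred L N fun q : Γ × Δ => P q.1 q.2) :
    IsDefinablePred L N fun g => ∃ d, P g d := by
  refine Eq.mp ?_ (Set.Definable.exists_of_finite hP)
  congr 1
  ext v
  simp only [Set.mem_ofPred_eq]
  exact (Coords.equiv (N := N) (Γ := Δ)).symm.exists_congr fun _ => Iff.rfl

@[fun_prop]
theorem all {P : Γ → Δ → Prop} (hP : IsDefinablePred L N fun q : Γ × Δ => P q.1 q.2) :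
    IsDefinablePred L N fun g => ∀ d, P g d :=
  (ex (P := fun g d => ¬ P g d) hP.not).not.congr fun _ => by simp

theorem allFinite {β : Type*} [Finite β] {P : Γ → β → Prop}
    (hP : ∀ i, IsDefinablePred L N fun g => P g i) : IsDefinablePred L N fun g => ∀ i, P g i := by
  simpa only [IsDefinablePred, Set.ofPred_forall] using! Set.definable_iInter_of_finite hP

theorem exFinite {β : Type*} [Finite β] {P : Γ → β → Prop}
    (hP : ∀ i, IsDefinablePred L N fun g => P g i) : IsDefinablePred L N fun g => ∃ i, P g i := by
  simpa only [IsDefinablePred, Set.ofPred_exists] using! Set.definable_iUnion_of_finite hP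

@[fun_prop]
theorem eq {f h : Γ → Δ} (hf : IsDefinableMap L N f) (hh : IsDefinableMap L N h) :
    IsDefinablePred L N fun g => f g = h g := by
  have := Set.definable_iInter_of_finite fun i => (hf i).ofPred_eq (hh i)
  rw [← Set.ofPred_forall] at this
  simpa only [IsDefinablePred, ← Equiv.apply_eq_iff_eq (Coords.equiv (N := N) (Γ := Δ)), funext_iff]

end IsDefinablePred

@[fun_prop]
theorem IsDefinable.mem {S : Set Δ} (hS : IsDefinable L N S) {f : Γ → Δ}
    (hf : IsDefinableMap L N f) : IsDefinablePred L N fun g => f g ∈ S :=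
  IsDefinablePred.comp hS hf

theorem isDefinable_setOf {P : Γ → Prop} (hP : IsDefinablePred L N P) :
    IsDefinable L N {g | P g} := hP

theorem isDefinable_iff_definable {β : Type} [Finite β] {S : Set (β → N)} :
    IsDefinable L N S ↔ (Set.univ : Set N).Definable L S := Iff.rfl

theorem isDefinable_iff_definable₁ {S : Set N} :
    IsDefinable L N S ↔ (Set.univ : Set N).Definable₁ L S :=
  ⟨fun h => h.mem (f := fun x : Fin 1 → N => x 0) (by fun_prop),
    fun h => IsDefinablePred.comp (P := fun x : Fin 1 → N => x 0 ∈ S) h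
      (f := fun x _ => x) (by fun_prop)⟩

end Definability

section UniformFiniteness

/-- The formula saying that at least `k` values of the last variable satisfy `φ`. -/
noncomputable def atLeast {L : FirstOrder.Language.{u, v}} {α : Type w} (k : ℕ)
    (φ : L.Formula (α ⊕ Unit)) : L.Formula α :=
  Formula.iExs (Fin k)
    ((Formula.iInf fun p : {p : Fin k × Fin k // p.1 ≠ p.2} =>
      ∼(Term.equal (.var (.inr p.1.1)) (.var (.inr p.1.2)))) ⊓
    Formula.iInf fun i => φ.relabel (Sum.map id fun _ => i))

theorem le_ncard_iff_exists_injective {X : Type*} {T : Set X} (hT : T.Finite) {k : ℕ} :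
    k ≤ T.ncard ↔ ∃ y : Fin k → X, Function.Injective y ∧ ∀ i, y i ∈ T := by
  constructor
  · intro h
    have := hT.fintype
    obtain ⟨f⟩ := Function.Embedding.nonempty_of_card_le (α := Fin k) (β := T)
      (by rwa [Fintype.card_fin, ← Nat.card_eq_fintype_card, Nat.card_coe_set_eq])
    exact ⟨fun i => f i, Subtype.val_injective.comp f.injective, fun i => (f i).2⟩
  · rintro ⟨y, hy, hyT⟩
    have := Set.ncard_le_ncard (Set.range_subset_iff.2 hyT) hT
    rwa [← Set.image_univ, Set.ncard_image_of_injective _ hy, Set.ncard_univ, Nat.card_fin] at this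

theorem realize_atLeast {L : FirstOrder.Language.{u, v}} {α : Type w} {k : ℕ}
    {φ : L.Formula (α ⊕ Unit)} {S : Type w'} [L.Structure S] {b : α → S}
    (hfin : {t | φ.Realize (Sum.elim b fun _ => t)}.Finite) :
    (atLeast k φ).Realize b ↔ k ≤ {t | φ.Realize (Sum.elim b fun _ => t)}.ncard := by
  rw [le_ncard_iff_exists_injective hfin, atLeast, Formula.realize_iExs]
  refine exists_congr fun y => ?_
  rw [Formula.realize_inf, Formula.realize_iInf, Formula.realize_iInf]
  refine and_congr ?_ (forall_congr' fun i => ?_)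
  · simp [Function.injective_iff_pairwise_ne, Pairwise]
  · rw [Formula.realize_relabel, Set.mem_ofPred_eq]
    exact iff_of_eq (congrArg _ (funext (by rintro (_ | _) <;> rfl)))

variable (L : FirstOrder.Language.{u, v}) (N : Type w) [L.Structure N]

/-- In every definable family of finite subsets of `N`, the sets have bounded cardinality. -/
def HasUniformFiniteness : Prop :=
  ∀ {m : ℕ} (S : Set ((Fin m → N) × N)), IsDefinable L N S → (∀ g, {t | (g, t) ∈ S}.Finite) →
    ∃ e : ℕ, ∀ g, {t | (g, t) ∈ S}.ncard ≤ e

variable {L N}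

theorem IsDefinableMap.equiv_symm {Γ : Type w} [Coords N Γ] {β : Type} [Finite β]
    (ε : Coords.idx N Γ → β) :
    IsDefinableMap L N fun v : β → N => (Coords.equiv.symm (v ∘ ε) : Γ) := fun i => by
  simpa only [Equiv.apply_symm_apply] using! Set.DefinableFun.proj L

theorem HasUniformFiniteness.exists_bound (hN : HasUniformFiniteness L N) {Γ : Type w} [Coords N Γ]
    {S : Set (Γ × N)} (hS : IsDefinable L N S) (hfin : ∀ g, {t | (g, t) ∈ S}.Finite) :
    ∃ e : ℕ, ∀ g, {t | (g, t) ∈ S}.ncard ≤ e := by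
  obtain ⟨m, ⟨ε⟩⟩ := Finite.exists_equiv_fin (Coords.idx N Γ)
  obtain ⟨e, he⟩ := hN {q : (Fin m → N) × N | (Coords.equiv.symm (q.1 ∘ ε), q.2) ∈ S}
    (hS.mem (.prodMk (.comp (f := fun v => Coords.equiv.symm (v ∘ ε)) (.equiv_symm ε)
      (by fun_prop)) (by fun_prop))) fun g => hfin (Coords.equiv.symm (g ∘ ε))
  exact ⟨e, fun g => by
    simpa only [Set.mem_ofPred_eq, Function.comp_assoc, Equiv.symm_comp_self, Function.comp_id,
      Equiv.symm_apply_apply] using he (Coords.equiv g ∘ ε.symm)⟩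

theorem IsSaturated.hasUniformFiniteness {κ : Cardinal.{w}} (hκ : ℵ₀ ≤ κ)
    (h : IsSaturated L N κ) : HasUniformFiniteness L N := by
  classical
  intro m S hS hfin
  obtain ⟨A, -, hA⟩ := Set.definable_iff_finitely_definable.1 hS
  obtain ⟨φ, hφ⟩ : ∃ φ : L[[(A : Set N)]].Formula (Fin m ⊕ Unit),
      ∀ g t, φ.Realize (Sum.elim g fun _ => t) ↔ (g, t) ∈ S :=
    hA.imp fun φ hφ g t => (Set.ext_iff.1 hφ (Sum.elim g fun _ => t)).symm
  have hlarge (k : ℕ) (g : Fin m → N) :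
      (atLeast k φ).Realize g ↔ k ≤ {t | (g, t) ∈ S}.ncard := by
    have := realize_atLeast (k := k) (φ := φ) (b := g) (by simpa only [hφ] using hfin g)
    simpa only [hφ] using this
  by_contra! hunbounded
  obtain ⟨b, hb⟩ := h A ((Cardinal.lt_aleph0_of_finite _).trans_le hκ) m
      (Set.range fun k => atLeast k φ) fun p₀ hp₀ hfin₀ => by
    obtain ⟨p₀, rfl⟩ := hfin₀.exists_finset_coe
    rw [← Set.image_univ] at hp₀
    obtain ⟨I, -, rfl⟩ := Finset.subset_set_image_iff.1 hp₀
    obtain ⟨g, hg⟩ := hunbounded (I.sup id)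
    refine ⟨g, Finset.forall_mem_image.2 fun k hk => ?_⟩
    exact (hlarge k g).2 ((Finset.le_sup (f := id) hk).trans hg.le)
  exact absurd ((hlarge _ b).1 (hb _ ⟨_, rfl⟩)) (Nat.lt_succ_self _).not_ge

end UniformFiniteness

section Grid

theorem card_filter_piFinset_mul_card_le {ι X : Type*} [Fintype ι] [DecidableEq ι]
    {C : Set (ι → X)} [DecidablePred (· ∈ C)] {e : ℕ} {S : ι → Finset X} {j : ι}
    (hC : ∀ y ∈ Fintype.piFinset S, {t ∈ S j | Function.update y j t ∈ C}.card ≤ e) :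
    {y ∈ Fintype.piFinset S | y ∈ C}.card * (S j).card ≤ (Fintype.piFinset S).card * e := by
  rw [← Finset.card_product]
  -- Exchange `t` with the `j`-th coordinate of `y`.
  calc ({y ∈ Fintype.piFinset S | y ∈ C} ×ˢ S j).card
      ≤ ((Fintype.piFinset S).sigma fun y => {t ∈ S j | Function.update y j t ∈ C}).card := by
        refine Finset.card_le_card_of_injOn (fun q => ⟨Function.update q.1 j q.2, q.1 j⟩) ?_ ?_
        · rintro ⟨y, t⟩ hq
          simp only [Finset.coe_product, Finset.coe_filter, Set.mem_prod, Set.mem_ofPred_eq,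
            Fintype.mem_piFinset, Finset.mem_coe] at hq
          simp only [Finset.mem_coe, Finset.mem_sigma, Fintype.mem_piFinset, Finset.mem_filter,
            Function.update_idem, Function.update_eq_self]
          exact ⟨(Function.forall_update_iff _ fun i x => x ∈ S i).2 ⟨hq.2, fun i _ => hq.1.1 i⟩,
            hq.1.1 j, hq.1.2⟩
        · rintro ⟨y, t⟩ - ⟨y', t'⟩ - h
          simp only [Sigma.mk.injEq, heq_eq_eq] at h
          have ht : t = t' := by simpa using congrFun h.1 j
          have hy : y = y' := by
            rw [← Function.update_eq_self j y, ← Function.update_idem t, h.1, h.2,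
              Function.update_idem, Function.update_eq_self]
          exact Prod.ext hy ht
    _ = ∑ y ∈ Fintype.piFinset S, {t ∈ S j | Function.update y j t ∈ C}.card :=
        Finset.card_sigma _ _
    _ ≤ (Fintype.piFinset S).card * e := Finset.sum_le_card_nsmul _ _ _ hC

theorem exists_mem_piFinset_forall_notMem {ι X : Type*} [Fintype ι] [DecidableEq ι]
    {C : ι → Set (ι → X)} [∀ j, DecidablePred (· ∈ C j)] {e : ℕ} {S : ι → Finset X}
    (hC : ∀ j, ∀ y ∈ Fintype.piFinset S, {t ∈ S j | Function.update y j t ∈ C j}.card ≤ e)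
    (hS : ∀ i, Fintype.card ι * e < (S i).card) : ∃ y ∈ Fintype.piFinset S, ∀ j, y ∉ C j := by
  classical
  by_contra! hcover
  have hne : 0 < (Fintype.piFinset S).card :=
    (Fintype.piFinset_nonempty.2 fun i => Finset.card_pos.1 (pos_of_gt (hS i))).card_pos
  have hle : (Fintype.piFinset S).card ≤ ∑ j, {y ∈ Fintype.piFinset S | y ∈ C j}.card := by
    refine (Finset.card_le_card fun y hy => ?_).trans Finset.card_biUnion_le
    obtain ⟨j, hj⟩ := hcover y hy
    exact Finset.mem_biUnion.2 ⟨j, Finset.mem_univ _, Finset.mem_filter.2 ⟨hy, hj⟩⟩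
  refine (?_ : (Fintype.piFinset S).card * (Fintype.card ι * e) <
    (Fintype.piFinset S).card * (Fintype.card ι * e + 1)).not_ge ?_
  · exact Nat.mul_lt_mul_of_pos_left (Nat.lt_succ_self _) hne
  calc (Fintype.piFinset S).card * (Fintype.card ι * e + 1)
      ≤ ∑ j, {y ∈ Fintype.piFinset S | y ∈ C j}.card * (Fintype.card ι * e + 1) := by
        rw [← Finset.sum_mul]
        exact Nat.mul_le_mul_right _ hle
    _ ≤ ∑ _j : ι, (Fintype.piFinset S).card * e := Finset.sum_le_sum fun j _ =>
        (Nat.mul_le_mul_left _ (hS j)).trans (card_filter_piFinset_mul_card_le (hC j))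
    _ = (Fintype.piFinset S).card * (Fintype.card ι * e) := by
        rw [Finset.sum_const, Finset.card_univ, smul_eq_mul]
        ring

theorem exists_grid_subset_of_isOpen {ι X : Type*} [Finite ι] [TopologicalSpace X]
    (hX : ∀ U : Set X, IsOpen U → U.Nonempty → U.Infinite) {O : Set (ι → X)}
    (hO : IsOpen O) (hne : O.Nonempty) (s : ℕ) :
    ∃ S : ι → Finset X, (∀ i, (S i).card = s) ∧ ∀ y, (∀ i, y i ∈ S i) → y ∈ O := by
  obtain ⟨y, hy⟩ := hne
  obtain ⟨U, hU, hUO⟩ := isOpen_pi_iff'.1 hO y hy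
  choose S hSU hS using fun i => (hX (U i) (hU i).1 ⟨_, (hU i).2⟩).exists_subset_card_eq s
  exact ⟨S, hS, fun z hz => hUO fun i _ => hSU i (hz i)⟩

theorem infinite_of_isOpen_pi {ι X : Type*} [Nonempty ι] [TopologicalSpace X]
    (hX : ∀ U : Set X, IsOpen U → U.Nonempty → U.Infinite) {O : Set (ι → X)}
    (hO : IsOpen O) (hne : O.Nonempty) : O.Infinite :=
  let ⟨i⟩ := ‹Nonempty ι›
  (hX _ (isOpenMap_eval i O hO) (hne.image _)).of_image _

end Grid

section Thin

variable (L : FirstOrder.Language.{u, v}) (N : Type w) [L.Structure N] {Γ : Type w} [Coords N Γ]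

/-- The family `Y` of subsets of `N ^ m` is covered by a definable family of sets `C j`, `j < m`,
such that every line in direction `j` meets `C j` in a finite set. -/
def IsThin {m : ℕ} (Y : Set (Γ × (Fin m → N))) : Prop :=
  ∃ C : Fin m → Set (Γ × (Fin m → N)), (∀ j, IsDefinable L N (C j)) ∧ Y ⊆ ⋃ j, C j ∧
    ∀ j g y, {t | (g, Function.update y j t) ∈ C j}.Finite

variable {L N}

theorem IsThin.exists_bound (hN : HasUniformFiniteness L N) {m : ℕ} {Y : Set (Γ × (Fin m → N))}
    (hY : IsThin L N Y) : ∃ s : ℕ, ∀ g (S : Fin m → Finset N), (∀ i, (S i).card = s) →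
      ∃ y, (∀ i, y i ∈ S i) ∧ (g, y) ∉ Y := by
  classical
  obtain ⟨C, hC, hYC, hfin⟩ := hY
  have hbound (j) : ∃ e : ℕ, ∀ q : Γ × (Fin m → N),
      {t | (q.1, Function.update q.2 j t) ∈ C j}.ncard ≤ e := by
    have hCj := hC j
    exact hN.exists_bound
      (S := {q : (Γ × (Fin m → N)) × N | (q.1.1, Function.update q.1.2 j q.2) ∈ C j})
      (isDefinable_setOf (by fun_prop (disch := assumption))) fun q => hfin j q.1 q.2
  choose e he using hbound
  have hline (S : Fin m → Finset N) (g j y) :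
      {t ∈ S j | (g, Function.update y j t) ∈ C j}.card ≤ Finset.univ.sup e :=
    calc _ = (({t ∈ S j | (g, Function.update y j t) ∈ C j} : Finset N) : Set N).ncard :=
          (Set.ncard_coe_finset _).symm
      _ ≤ {t | (g, Function.update y j t) ∈ C j}.ncard :=
          Set.ncard_le_ncard (fun t ht => (Finset.mem_filter.1 ht).2) (hfin j g y)
      _ ≤ Finset.univ.sup e := (he j (g, y)).trans (Finset.le_sup (Finset.mem_univ j))
  refine ⟨m * Finset.univ.sup e + 1, fun g S hS => ?_⟩
  obtain ⟨y, hy, hyC⟩ := exists_mem_piFinset_forall_notMem (C := fun j => {y | (g, y) ∈ C j})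
    (fun j y _ => hline S g j y) fun i => by simp [hS]
  exact ⟨y, Fintype.mem_piFinset.1 hy, fun hyY => (Set.mem_iUnion.1 (hYC hyY)).elim hyC⟩

theorem IsThin.iUnion {m : ℕ} {ι : Type*} [Finite ι] {Y : ι → Set (Γ × (Fin m → N))}
    (hY : ∀ i, IsThin L N (Y i)) : IsThin L N (⋃ i, Y i) := by
  choose C hC hYC hfin using hY
  refine ⟨fun j => ⋃ i, C i j, fun j => ?_, ?_, fun j g y => ?_⟩
  · exact (IsDefinablePred.exFinite fun i => hC i j).congr fun q => Set.mem_iUnion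
  · rw [Set.iUnion_comm]
    exact Set.iUnion_mono hYC
  · simpa only [Set.mem_iUnion, Set.ofPred_exists] using Set.finite_iUnion fun i => hfin i j g y

end Thin

section DefinableTopology

variable (L : FirstOrder.Language.{u, v}) (N : Type w) [L.Structure N]
  {Γ Δ Θ : Type w} [Coords N Γ] [Coords N Δ] [Coords N Θ]

/-- The fibres of the definable set `B` form a basis of open sets of `Δ`. Unlike in
`IsDefinableTopology`, the family is indexed by a full power of `N`; fibres may be empty. -/
structure IsDefinableBasis [TopologicalSpace Δ] (B : Set (Θ × Δ)) : Prop where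
  definable : IsDefinable L N B
  isOpen : ∀ d, IsOpen {x | (d, x) ∈ B}
  exists_subset : ∀ ⦃x : Δ⦄ ⦃U : Set Δ⦄, IsOpen U → x ∈ U →
    ∃ d, (d, x) ∈ B ∧ ∀ y, (d, y) ∈ B → y ∈ U

variable {L N}

theorem IsDefinableTopology.exists_isDefinableBasis [τ : TopologicalSpace N]
    (h : IsDefinableTopology L N τ) :
    ∃ (r : ℕ) (B : Set ((Fin r → N) × N)), IsDefinableBasis L N B := by
  obtain ⟨r, D, B, hD, hB, hbasis⟩ := h
  refine ⟨r, {q | q.1 ∈ D ∧ Sum.elim q.1 (fun _ => q.2) ∈ B}, ?_, fun d => ?_, fun x U hU hx => ?_⟩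
  · rw [← isDefinable_iff_definable] at hD hB
    have hpair : IsDefinableMap L N fun q : (Fin r → N) × N =>
        (Sum.elim q.1 (fun _ => q.2) : Fin r ⊕ Unit → N) :=
      .pi (by rintro (i | i) <;> simp only [Sum.elim_inl, Sum.elim_inr] <;> fun_prop)
    exact (hD.mem (by fun_prop)).and (hB.mem hpair)
  · by_cases hd : d ∈ D
    · simpa [hd] using hbasis.isOpen ⟨d, hd, rfl⟩
    · simp [hd]
  · obtain ⟨_, ⟨d, hd, rfl⟩, hxd, hdU⟩ := hbasis.exists_subset_of_mem_open hx hU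
    exact ⟨d, ⟨hd, hxd⟩, fun y hy => hdU hy.2⟩

theorem IsDefinableBasis.pi [TopologicalSpace N] {κ : Type} [Finite κ] {B : Set ((κ → N) × N)}
    (hB : IsDefinableBasis L N B) (ι : Type) [Finite ι] :
    IsDefinableBasis L N
      {q : (ι × κ → N) × (ι → N) | ∀ i, ((fun j => q.1 (i, j)), q.2 i) ∈ B} where
  definable := by
    have := hB.definable
    exact .allFinite fun i => by fun_prop (disch := assumption)
  isOpen d := by
    simpa only [Set.pi, Set.mem_univ, true_imp_iff] using!
      isOpen_set_pi Set.finite_univ fun i _ => hB.isOpen fun j => d (i, j)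
  exists_subset x U hU hx := by
    obtain ⟨V, hV, hVU⟩ := isOpen_pi_iff'.1 hU _ hx
    choose d hxd hdV using fun i => hB.exists_subset (hV i).1 (hV i).2
    exact ⟨fun p => d p.1 p.2, hxd, fun y hy => hVU fun i _ => hdV i _ (hy i)⟩

theorem IsDefinableBasis.mem_interior [TopologicalSpace Δ] {B : Set (Θ × Δ)}
    (hB : IsDefinableBasis L N B) {f : Γ → Δ} (hf : IsDefinableMap L N f) {P : Γ → Δ → Prop}
    (hP : IsDefinablePred L N fun q : Γ × Δ => P q.1 q.2) :
    IsDefinablePred L N fun g => f g ∈ interior {x | P g x} := by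
  have hBdef := hB.definable
  refine IsDefinablePred.congr (P := fun g => ∃ d, (d, f g) ∈ B ∧ ∀ x, (d, x) ∈ B → P g x)
    (.ex (.and (by fun_prop (disch := assumption)) (.all (.imp (by fun_prop (disch := assumption))
      (hP.comp (f := fun q : (Γ × Θ) × Δ => (q.1.1, q.2)) (by fun_prop)))))) fun g => ?_
  rw [_root_.mem_interior]
  constructor
  · rintro ⟨t, ht, hto, hqt⟩
    obtain ⟨d, hqd, hdt⟩ := hB.exists_subset hto hqt
    exact ⟨d, hqd, fun x hx => ht (hdt x hx)⟩
  · rintro ⟨d, hqd, hdP⟩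
    exact ⟨_, hdP, hB.isOpen d, hqd⟩

end DefinableTopology

section TMinimal

/-- A definable topology on `N`, not necessarily Hausdorff, for which the definable subsets of `N`
with non-empty interior are the infinite ones. -/
structure IsPreTMinimalTopology (L : FirstOrder.Language.{u, v}) (N : Type w) [L.Structure N]
    (τ : TopologicalSpace N) : Prop where
  definable : IsDefinableTopology L N τ
  interior_nonempty_iff : ∀ X : Set N, IsDefinable L N X → ((interior X).Nonempty ↔ X.Infinite)

variable {L : FirstOrder.Language.{u, v}} {N : Type w} [L.Structure N] [τ : TopologicalSpace N]
  {Γ : Type w} [Coords N Γ]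

theorem IsTMinimalTopology.isPreTMinimalTopology (hτ : IsTMinimalTopology L N τ) :
    IsPreTMinimalTopology L N τ :=
  ⟨hτ.definable, fun X hX => hτ.interior_nonempty_iff X (isDefinable_iff_definable₁.1 hX)⟩

theorem interior_diff_interior {X : Type*} [TopologicalSpace X] (s : Set X) :
    interior (s \ interior s) = ∅ :=
  Set.eq_empty_of_forall_notMem fun _ hx =>
    (interior_subset hx).2 (interior_mono Set.sdiff_subset hx)

namespace IsPreTMinimalTopology

@[fun_prop]
theorem mem_interior (hτ : IsPreTMinimalTopology L N τ) {f : Γ → N} (hf : IsDefinableMap L N f)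
    {P : Γ → N → Prop} (hP : IsDefinablePred L N fun q : Γ × N => P q.1 q.2) :
    IsDefinablePred L N fun g => f g ∈ interior {x | P g x} :=
  let ⟨_, _, hB⟩ := hτ.definable.exists_isDefinableBasis
  hB.mem_interior hf hP

@[fun_prop]
theorem mem_interior_pi (hτ : IsPreTMinimalTopology L N τ) {ι : Type} [Finite ι] {f : Γ → ι → N}
    (hf : IsDefinableMap L N f) {P : Γ → (ι → N) → Prop}
    (hP : IsDefinablePred L N fun q : Γ × (ι → N) => P q.1 q.2) :
    IsDefinablePred L N fun g => f g ∈ interior {x | P g x} :=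
  let ⟨_, _, hB⟩ := hτ.definable.exists_isDefinableBasis
  (hB.pi ι).mem_interior hf hP

theorem infinite_of_isOpen (hτ : IsPreTMinimalTopology L N τ) {U : Set N} (hU : IsOpen U)
    (hne : U.Nonempty) : U.Infinite := by
  intro hfin
  have := hfin.to_subtype
  have hdef : IsDefinable L N U :=
    IsDefinablePred.congr (P := fun x : N => ∃ u : U, x = u) (.exFinite fun u => by fun_prop)
      fun x => by simp
  exact (hτ.interior_nonempty_iff U hdef).1
    (hU.interior_eq.symm ▸ hne) hfin

theorem finite_diff_interior (hτ : IsPreTMinimalTopology L N τ) {X : Set N}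
    (hX : IsDefinable L N X) : (X \ interior X).Finite := by
  by_contra hinf
  have hdef : IsDefinable L N (X \ interior X) :=
    isDefinable_setOf (P := fun x => x ∈ X ∧ x ∉ interior {y | y ∈ X})
      (by fun_prop (disch := assumption))
  have := (hτ.interior_nonempty_iff _ hdef).2 hinf
  simp [interior_diff_interior] at this

end IsPreTMinimalTopology

theorem IsThin.interior_eq_empty (hN : HasUniformFiniteness L N) (hτ : IsPreTMinimalTopology L N τ)
    {m : ℕ} {Y : Set (Γ × (Fin m → N))} (hY : IsThin L N Y) (g : Γ) :
    interior {y | (g, y) ∈ Y} = ∅ := by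
  obtain ⟨s, hs⟩ := hY.exists_bound hN
  by_contra! hne
  obtain ⟨S, hS, hSY⟩ := exists_grid_subset_of_isOpen (fun _ => hτ.infinite_of_isOpen)
    isOpen_interior hne s
  obtain ⟨y, hyS, hyY⟩ := hs g S hS
  exact hyY (interior_subset (hSY y hyS) : y ∈ {y | (g, y) ∈ Y})

theorem interior_setOf_forall_cons_mem_eq_empty {X : Type*} [TopologicalSpace X] {m : ℕ}
    {Y : Set (Fin (m + 1) → X)} (hY : interior Y = ∅) {V : Set X} (hV : IsOpen V)
    (hne : V.Nonempty) : interior {y | ∀ x ∈ V, (Fin.cons x y : Fin (m + 1) → X) ∈ Y} = ∅ := by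
  by_contra! hint
  obtain ⟨⟨y, hy⟩, ⟨x, hx⟩⟩ := And.intro hint hne
  have hopen : IsOpen {w : Fin (m + 1) → X | w 0 ∈ V ∧
      Fin.tail w ∈ interior {y | ∀ x ∈ V, (Fin.cons x y : Fin (m + 1) → X) ∈ Y}} :=
    (hV.preimage (continuous_apply 0)).inter
      (isOpen_interior.preimage (continuous_pi fun i => continuous_apply i.succ))
  have hmem : (Fin.cons x y : Fin (m + 1) → X) ∈ interior Y :=
    mem_interior.2 ⟨_, fun w hw => by simpa using interior_subset hw.2 _ hw.1, hopen,
      by simpa using! ⟨hx, hy⟩⟩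
  exact hY.subset hmem

/-- The points of `Y` interior to the line in direction `0` through them, as a family of subsets
of `N ^ m` indexed by the parameter of `Y` and the coordinate `0`. -/
def lineInterior {m : ℕ} (Y : Set (Γ × (Fin (m + 1) → N))) : Set ((Γ × N) × (Fin m → N)) :=
  {q | q.1.2 ∈ interior {x | (q.1.1, (Fin.cons x q.2 : Fin (m + 1) → N)) ∈ Y}}

theorem IsPreTMinimalTopology.isDefinable_lineInterior (hτ : IsPreTMinimalTopology L N τ) {m : ℕ}
    {Y : Set (Γ × (Fin (m + 1) → N))} (hY : IsDefinable L N Y) :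
    IsDefinable L N (lineInterior Y) :=
  isDefinable_setOf (by fun_prop (disch := assumption))

theorem interior_lineInterior_eq_empty (hN : HasUniformFiniteness L N)
    (hτ : IsPreTMinimalTopology L N τ) {m : ℕ} {Y : Set (Γ × (Fin (m + 1) → N))} {Θ : Type w}
    [Coords N Θ] {B : Set (Θ × N)} (hB : IsDefinableBasis L N B)
    (hthin : IsThin L N {q : (Γ × Θ) × (Fin m → N) | (∃ x, (q.1.2, x) ∈ B) ∧
      ∀ x, (q.1.2, x) ∈ B → (q.1.1, (Fin.cons x q.2 : Fin (m + 1) → N)) ∈ Y})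
    (p : Γ × N) : interior {y | (p, y) ∈ lineInterior Y} = ∅ := by
  obtain ⟨s, hs⟩ := hthin.exists_bound hN
  by_contra! hne
  obtain ⟨S, hS, hSZ⟩ := exists_grid_subset_of_isOpen (fun _ => hτ.infinite_of_isOpen)
    isOpen_interior hne s
  have hfin : {y : Fin m → N | ∀ i, y i ∈ S i}.Finite := by
    simpa only [Set.pi, Set.mem_univ, true_imp_iff] using!
      Set.Finite.pi' fun i => (S i).finite_toSet
  have hmem : p.2 ∈ ⋂ y ∈ {y | ∀ i, y i ∈ S i},
      interior {x | (p.1, (Fin.cons x y : Fin (m + 1) → N)) ∈ Y} :=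
    Set.mem_iInter₂.2 fun y hy => interior_subset (s := {y | (p, y) ∈ lineInterior Y}) (hSZ y hy)
  -- One basic neighbourhood of `p.2` serves all the points of the grid.
  obtain ⟨d, hpd, hdY⟩ := hB.exists_subset (hfin.isOpen_biInter fun _ _ => isOpen_interior) hmem
  obtain ⟨y, hyS, hyZ⟩ := hs (p.1, d) S hS
  exact hyZ ⟨⟨p.2, hpd⟩, fun x hx =>
    (interior_subset (Set.mem_iInter₂.1 (hdY x hx) y hyS) : x ∈ {x | (p.1, Fin.cons x y) ∈ Y})⟩

theorem IsThin.of_lineInterior (hτ : IsPreTMinimalTopology L N τ) {m : ℕ}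
    {Y : Set (Γ × (Fin (m + 1) → N))} (hY : IsDefinable L N Y)
    (hZ : IsThin L N (lineInterior Y)) : IsThin L N Y := by
  have hZdef := hτ.isDefinable_lineInterior hY
  obtain ⟨C, hC, hZC, hfin⟩ := hZ
  refine ⟨Fin.cases {q | q ∈ Y ∧ ((q.1, q.2 0), Fin.tail q.2) ∉ lineInterior Y}
    fun j => {q | ((q.1, q.2 0), Fin.tail q.2) ∈ C j}, ?_, fun q hq => ?_, ?_⟩
  · have hf : IsDefinableMap L N fun q : Γ × (Fin (m + 1) → N) =>
        ((q.1, q.2 0), Fin.tail q.2) := by fun_prop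
    exact Fin.cases (IsDefinablePred.and hY (hZdef.mem hf).not) fun j => (hC j).mem hf
  · by_cases h : ((q.1, q.2 0), Fin.tail q.2) ∈ lineInterior Y
    · obtain ⟨j, hj⟩ := Set.mem_iUnion.1 (hZC h)
      exact Set.mem_iUnion.2 ⟨j.succ, hj⟩
    · exact Set.mem_iUnion.2 ⟨0, hq, h⟩
  · refine Fin.cases (fun g y => ?_) fun j g y => ?_
    · cases y using Fin.consCases with | cons x y => ?_
      have hline : IsDefinable L N {x | (g, (Fin.cons x y : Fin (m + 1) → N)) ∈ Y} :=
        isDefinable_setOf (by fun_prop (disch := assumption))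
      refine (hτ.finite_diff_interior hline).subset fun t ht => ?_
      simpa [lineInterior, Fin.update_cons_zero] using! ht
    · simpa [Fin.tail_update_succ] using! hfin j (g, y 0) (Fin.tail y)

theorem isThin_of_interior_eq_empty (hN : HasUniformFiniteness L N)
    (hτ : IsPreTMinimalTopology L N τ) {m : ℕ} {Γ : Type w} [Coords N Γ] {Y : Set (Γ × (Fin m → N))}
    (hY : IsDefinable L N Y) (hint : ∀ g, interior {y | (g, y) ∈ Y} = ∅) : IsThin L N Y := by
  induction m generalizing Γ with
  | zero =>
    refine ⟨fun j => j.elim0, fun j => j.elim0, fun ⟨g, y⟩ hgy => ?_, fun j => j.elim0⟩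
    have huniv : {y | (g, y) ∈ Y} = Set.univ := Subsingleton.eq_univ_of_nonempty ⟨y, hgy⟩
    simpa [huniv] using hint g
  | succ m ih =>
    obtain ⟨r, B, hB⟩ := hτ.definable.exists_isDefinableBasis
    have hBdef := hB.definable
    refine .of_lineInterior hτ hY (ih (hτ.isDefinable_lineInterior hY) fun p =>
      interior_lineInterior_eq_empty hN hτ hB (ih ?_ fun q => ?_) p)
    · exact isDefinable_setOf (by fun_prop (disch := assumption))
    · by_cases hne : ∃ x, (q.2, x) ∈ B
      · simpa only [Set.mem_ofPred_eq, hne, true_and] using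
          interior_setOf_forall_cons_mem_eq_empty (hint q.1) (hB.isOpen q.2) hne
      · simp [hne]

theorem interior_iUnion_eq_empty (hN : HasUniformFiniteness L N)
    (hτ : IsPreTMinimalTopology L N τ) {m : ℕ} {ι : Type*} [Finite ι] {Y : ι → Set (Fin m → N)}
    (hY : ∀ i, IsDefinable L N (Y i)) (hint : ∀ i, interior (Y i) = ∅) :
    interior (⋃ i, Y i) = ∅ := by
  have hthin : IsThin L N (⋃ i, {q : (Fin 0 → N) × (Fin m → N) | q.2 ∈ Y i}) :=
    .iUnion fun i => isThin_of_interior_eq_empty hN hτ ((hY i).mem (by fun_prop)) fun _ => hint i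
  simpa only [Set.mem_iUnion, Set.mem_ofPred_eq, ← Set.iUnion_ofPred, Set.ofPred_mem_eq] using
    hthin.interior_eq_empty hN hτ Fin.elim0

end TMinimal

section FiniteToFinite

open scoped SetRel

/-- A relation in which every point, on either side, is related to only finitely many points. -/
structure IsFiniteToFinite {X Y : Type*} (R : SetRel X Y) : Prop where
  finite_right : ∀ x, {y | (x, y) ∈ R}.Finite
  finite_left : ∀ y, {x | (x, y) ∈ R}.Finite

namespace IsFiniteToFinite

variable {X X' Y Y' Z : Type*} {R : SetRel X Y}

theorem mono {S : SetRel X Y} (hR : IsFiniteToFinite R) (h : S ⊆ R) : IsFiniteToFinite S :=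
  ⟨fun x => (hR.finite_right x).subset fun _ hy => h hy,
    fun y => (hR.finite_left y).subset fun _ hx => h hx⟩

theorem inv (hR : IsFiniteToFinite R) : IsFiniteToFinite R.inv :=
  ⟨hR.finite_left, hR.finite_right⟩

theorem finite_image (hR : IsFiniteToFinite R) {s : Set X} (hs : s.Finite) : (R.image s).Finite :=
  (hs.biUnion fun x _ => hR.finite_right x).subset fun _ ⟨_, hx, hxy⟩ => Set.mem_biUnion hx hxy

theorem comp {S : SetRel Y Z} (hR : IsFiniteToFinite R) (hS : IsFiniteToFinite S) :
    IsFiniteToFinite (R ○ S) :=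
  ⟨fun x => hS.finite_image (hR.finite_right x),
    fun z => (hR.inv.finite_image (hS.finite_left z)).subset fun _ ⟨y, hxy, hyz⟩ => ⟨y, hyz, hxy⟩⟩

theorem prodMap {S : SetRel X' Y'} (hR : IsFiniteToFinite R) (hS : IsFiniteToFinite S) :
    IsFiniteToFinite {q : (X × X') × (Y × Y') | (q.1.1, q.2.1) ∈ R ∧ (q.1.2, q.2.2) ∈ S} :=
  ⟨fun p => (hR.finite_right p.1).prod (hS.finite_right p.2),
    fun p => (hR.finite_left p.1).prod (hS.finite_left p.2)⟩

theorem comap_left (hR : IsFiniteToFinite R) {f : X' → X} (hf : Function.Injective f) :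
    IsFiniteToFinite {q : X' × Y | (f q.1, q.2) ∈ R} :=
  ⟨fun x => hR.finite_right (f x), fun y => ((hR.finite_left y).preimage hf.injOn :)⟩

end IsFiniteToFinite

theorem isFiniteToFinite_removeNth {X : Type*} {m : ℕ} {C : Set (Fin (m + 1) → X)}
    {j : Fin (m + 1)} (hC : ∀ y, {t | Function.update y j t ∈ C}.Finite) :
    IsFiniteToFinite {q : (Fin (m + 1) → X) × (Fin m → X) | q.1 ∈ C ∧ j.removeNth q.1 = q.2} where
  finite_right y := (Set.finite_singleton (j.removeNth y)).subset fun _ hz => hz.2.symm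
  finite_left z := by
    obtain h | ⟨y₀, -, rfl⟩ := Set.eq_empty_or_nonempty {y | y ∈ C ∧ j.removeNth y = z}
    · exact h ▸ Set.finite_empty
    refine ((hC y₀).image fun t => Function.update y₀ j t).subset fun y ⟨hyC, hy⟩ => ?_
    have : Function.update y₀ j (y j) = y := by
      rw [← Fin.insertNth_removeNth, ←
        show j.removeNth y = j.removeNth y₀ from hy, Fin.insertNth_self_removeNth]
    exact ⟨y j, by rwa [Set.mem_ofPred_eq, this], this⟩

end FiniteToFinite

section DimensionDrop

open scoped SetRel

variable {L : FirstOrder.Language.{u, v}} {N : Type w} [L.Structure N] [τ : TopologicalSpace N]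

variable (L N) in
/-- A definable finite-to-finite relation between `N ^ (m + 1)` and `N ^ m` has a domain with
empty interior. -/
def NoDimensionDrop (m : ℕ) : Prop :=
  ∀ R : SetRel (Fin (m + 1) → N) (Fin m → N), IsDefinable L N R → IsFiniteToFinite R →
    interior R.dom = ∅

theorem noDimensionDrop_zero (hτ : IsPreTMinimalTopology L N τ) : NoDimensionDrop L N 0 := by
  intro R _ hfin
  by_contra! hne
  have hdom : R.dom.Finite := (hfin.inv.finite_image Set.finite_univ).subset
    fun u ⟨b, hub⟩ => ⟨b, trivial, hub⟩
  exact infinite_of_isOpen_pi (fun _ => hτ.infinite_of_isOpen) isOpen_interior hne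
    (hdom.subset interior_subset)

theorem NoDimensionDrop.interior_dom_eq_empty (hN : HasUniformFiniteness L N)
    (hτ : IsPreTMinimalTopology L N τ) {m : ℕ} (hm : NoDimensionDrop L N m)
    {R : SetRel (Fin (m + 1) → N) (Fin (m + 1) → N)} (hR : IsDefinable L N R)
    (hfin : IsFiniteToFinite R) (hint : interior R.cod = ∅) : interior R.dom = ∅ := by
  obtain ⟨C, hC, hRC, hCfin⟩ := isThin_of_interior_eq_empty hN hτ
    (Y := {q : (Fin 0 → N) × (Fin (m + 1) → N) | ∃ u, (u, q.2) ∈ R})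
    (isDefinable_setOf (by fun_prop (disch := assumption))) fun _ => hint
  let P (j : Fin (m + 1)) : SetRel (Fin (m + 1) → N) (Fin m → N) :=
    {q | (Fin.elim0, q.1) ∈ C j ∧ j.removeNth q.1 = q.2}
  have hPfin (j) : IsFiniteToFinite (R ○ P j) :=
    hfin.comp (isFiniteToFinite_removeNth (C := {b | (Fin.elim0, b) ∈ C j}) (hCfin j Fin.elim0))
  have hPdef (j) : IsDefinable L N (R ○ P j) := by
    have hCj := hC j
    exact isDefinable_setOf (P := fun q : (Fin (m + 1) → N) × (Fin m → N) => ∃ b, (q.1, b) ∈ R ∧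
      ((Fin.elim0 : Fin 0 → N), b) ∈ C j ∧ j.removeNth b = q.2)
      (by fun_prop (disch := assumption))
  have hsub : R.dom ⊆ ⋃ j, (R ○ P j).dom := fun u ⟨b, hub⟩ =>
    let ⟨j, hj⟩ := Set.mem_iUnion.1 (hRC (a := (Fin.elim0, b)) ⟨u, hub⟩)
    Set.mem_iUnion.2 ⟨j, _, b, hub, hj, rfl⟩
  refine Set.subset_empty_iff.1 ((interior_mono hsub).trans
    (interior_iUnion_eq_empty hN hτ (fun j => ?_) fun j => hm _ (hPdef j) (hPfin j)).subset)
  have hPj := hPdef j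
  exact isDefinable_setOf (by fun_prop (disch := assumption))

section Slices

variable {k : ℕ} {X Y : Type*} [TopologicalSpace Y] (R : SetRel (Fin (k + 1) → X) Y)

/-- The points related by `R` to a point of `G` with `i`-th coordinate `a`. -/
def sliceImage (G : Set (Fin (k + 1) → X)) (i : Fin (k + 1)) (a : X) : Set Y :=
  R.image {u ∈ G | u i = a}

/-- The points of `G` related by `R` to a point that is not interior to the image of the slice of
`G` in direction `i` through them. -/
def badPoints (G : Set (Fin (k + 1) → X)) (i : Fin (k + 1)) : Set (Fin (k + 1) → X) :=
  {u ∈ G | ∃ b, (u, b) ∈ R ∧ b ∉ interior (sliceImage R G i (u i))}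

/-- The points of `G` all of whose `R`-related points are interior to the image of each of the
slices of `G` through them. -/
def goodPoints (G : Set (Fin (k + 1) → X)) : Set (Fin (k + 1) → X) :=
  {u ∈ G | ∀ i b, (u, b) ∈ R → b ∈ interior (sliceImage R G i (u i))}

variable {R}

theorem subset_goodPoints_union_iUnion_badPoints (G : Set (Fin (k + 1) → X)) :
    G ⊆ goodPoints R G ∪ ⋃ i, badPoints R G i := by
  intro u hu
  by_cases h : ∀ i b, (u, b) ∈ R → b ∈ interior (sliceImage R G i (u i))
  · exact .inl ⟨hu, h⟩
  · push Not at h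
    obtain ⟨i, b, hub, hb⟩ := h
    exact .inr (Set.mem_iUnion.2 ⟨i, hu, b, hub, hb⟩)

end Slices

section Definability

variable {k m : ℕ} {R : SetRel (Fin (k + 1) → N) (Fin m → N)} {G : Set (Fin (k + 1) → N)}

@[fun_prop]
theorem IsPreTMinimalTopology.mem_interior_sliceImage (hτ : IsPreTMinimalTopology L N τ)
    (hR : IsDefinable L N R) (hG : IsDefinable L N G) (i : Fin (k + 1)) {Γ : Type w} [Coords N Γ]
    {a : Γ → N} (ha : IsDefinableMap L N a) {b : Γ → Fin m → N} (hb : IsDefinableMap L N b) :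
    IsDefinablePred L N fun g => b g ∈ interior (sliceImage R G i (a g)) :=
  hτ.mem_interior_pi (P := fun g b => ∃ u, (u ∈ G ∧ u i = a g) ∧ (u, b) ∈ R) hb
    (by fun_prop (disch := assumption))

theorem IsPreTMinimalTopology.isDefinable_badPoints (hτ : IsPreTMinimalTopology L N τ)
    (hR : IsDefinable L N R) (hG : IsDefinable L N G) (i : Fin (k + 1)) :
    IsDefinable L N (badPoints R G i) :=
  isDefinable_setOf (by fun_prop (disch := assumption))

theorem IsPreTMinimalTopology.isDefinable_goodPoints (hτ : IsPreTMinimalTopology L N τ)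
    (hR : IsDefinable L N R) (hG : IsDefinable L N G) : IsDefinable L N (goodPoints R G) :=
  .and hG (.allFinite fun i => by fun_prop (disch := assumption))

end Definability

theorem NoDimensionDrop.interior_badPoints (hN : HasUniformFiniteness L N)
    (hτ : IsPreTMinimalTopology L N τ) {m : ℕ} (hm : NoDimensionDrop L N m)
    {R : SetRel (Fin (m + 2) → N) (Fin (m + 1) → N)} (hR : IsDefinable L N R)
    (hfin : IsFiniteToFinite R) {G : Set (Fin (m + 2) → N)} (hG : IsDefinable L N G)
    (i : Fin (m + 2)) : interior (badPoints R G i) = ∅ := by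
  refine Set.eq_empty_of_forall_notMem fun x hx => ?_
  let ins (u : Fin (m + 1) → N) : Fin (m + 2) → N := i.insertNth (x i) u
  let R' : SetRel (Fin (m + 1) → N) (Fin (m + 1) → N) :=
    {q | (ins q.1, q.2) ∈ R ∧ ins q.1 ∈ G ∧ q.2 ∉ interior (sliceImage R G i (x i))}
  have hR' : IsDefinable L N R' := isDefinable_setOf (by fun_prop (disch := assumption))
  have hfin' : IsFiniteToFinite R' :=
    (hfin.comap_left (f := ins) (Fin.insertNth_right_injective (α := fun _ => N) (x i))).mono
      fun _ hq => hq.1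
  have hcod : R'.cod ⊆ sliceImage R G i (x i) \ interior (sliceImage R G i (x i)) := by
    rintro b ⟨u, huR, huG, hb⟩
    exact ⟨⟨_, ⟨huG, Fin.insertNth_apply_same _ _ _⟩, huR⟩, hb⟩
  have hdom : interior R'.dom = ∅ := hm.interior_dom_eq_empty hN hτ hR' hfin'
    (Set.subset_empty_iff.1 ((interior_mono hcod).trans (interior_diff_interior _).subset))
  have hins : Continuous ins := continuous_const.finInsertNth i continuous_id
  have hmem : i.removeNth x ∈ interior R'.dom := by
    refine mem_interior.2 ⟨ins ⁻¹' interior (badPoints R G i), fun u hu => ?_,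
      isOpen_interior.preimage hins, by simpa [ins] using hx⟩
    obtain ⟨huG, b, hub, hb⟩ := interior_subset (s := badPoints R G i) hu
    exact ⟨b, hub, huG, by simpa [ins] using hb⟩
  exact hdom.subset hmem

theorem NoDimensionDrop.interior_goodPoints_nonempty (hN : HasUniformFiniteness L N)
    (hτ : IsPreTMinimalTopology L N τ) {m : ℕ} (hm : NoDimensionDrop L N m)
    {R : SetRel (Fin (m + 2) → N) (Fin (m + 1) → N)} (hR : IsDefinable L N R)
    (hfin : IsFiniteToFinite R) {G : Set (Fin (m + 2) → N)} (hG : IsDefinable L N G)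
    (hne : (interior G).Nonempty) : (interior (goodPoints R G)).Nonempty := by
  by_contra! hgood
  let Y (o : Option (Fin (m + 2))) := o.elim (goodPoints R G) (badPoints R G)
  have hY : G ⊆ ⋃ o, Y o := by
    simpa only [Set.iUnion_option] using! subset_goodPoints_union_iUnion_badPoints G
  have hempty : interior (⋃ o, Y o) = ∅ := interior_iUnion_eq_empty hN hτ
    (Option.forall.2 ⟨hτ.isDefinable_goodPoints hR hG, hτ.isDefinable_badPoints hR hG⟩)
    (Option.forall.2 ⟨hgood, hm.interior_badPoints hN hτ hR hfin hG⟩)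
  exact (hne.mono (interior_mono hY)).ne_empty hempty

theorem exists_isOpen_forall_eq_of_isOpen_setOf_mem {X Y : Type*} [TopologicalSpace X]
    {A : X → Set Y} (hA : ∀ a, IsOpen {x | a ∈ A x}) (hfin : ∀ x, (A x).Finite) {e : ℕ}
    (hcard : ∀ x, (A x).ncard ≤ e) {O : Set X} (hO : IsOpen O) (hne : O.Nonempty) :
    ∃ x ∈ O, ∃ V ⊆ O, IsOpen V ∧ x ∈ V ∧ ∀ y ∈ V, A y = A x := by
  have hbdd : BddAbove ((fun x => (A x).ncard) '' O) :=
    ⟨e, Set.forall_mem_image.2 fun x _ => hcard x⟩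
  obtain ⟨x, hxO, hx⟩ := Nat.sSup_mem (hne.image _) hbdd
  refine ⟨x, hxO, O ∩ ⋂ a ∈ A x, {y | a ∈ A y}, Set.inter_subset_left,
    hO.inter ((hfin x).isOpen_biInter fun a _ => hA a), ⟨hxO, Set.mem_iInter₂.2 fun _ ha => ha⟩,
    fun y ⟨hyO, hy⟩ => ?_⟩
  exact (Set.eq_of_subset_of_ncard_le (Set.mem_iInter₂.1 hy)
    ((le_csSup hbdd (Set.mem_image_of_mem _ hyO)).trans_eq hx.symm) (hfin y)).symm

theorem NoDimensionDrop.succ (hN : HasUniformFiniteness L N) (hτ : IsPreTMinimalTopology L N τ)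
    {m : ℕ} (hm : NoDimensionDrop L N m) : NoDimensionDrop L N (m + 1) := by
  intro R hR hfin
  by_contra! hne
  have hdom : IsDefinable L N R.dom := isDefinable_setOf (by fun_prop (disch := assumption))
  obtain ⟨u, hu⟩ := (hm.interior_goodPoints_nonempty hN hτ hR hfin
    (hτ.isDefinable_goodPoints hR hdom)
    (hm.interior_goodPoints_nonempty hN hτ hR hfin hdom hne)).mono interior_subset
  obtain ⟨b₀, hub₀⟩ := hu.1.1
  let A (b : Fin (m + 1) → N) : Set N := {a | ∃ i, b ∈ interior (sliceImage R R.dom i a)}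
  let S : Set ((Fin (m + 1) → N) × N) := {q | ∃ u, (u, q.1) ∈ R ∧ ∃ i, u i = q.2}
  have hAS (b) : A b ⊆ {a | (b, a) ∈ S} := by
    rintro a ⟨i, hi⟩
    obtain ⟨u, ⟨-, hua⟩, hub⟩ := interior_subset hi
    exact ⟨u, hub, i, hua⟩
  have hSfin (b) : {a | (b, a) ∈ S}.Finite := ((hfin.finite_left b).biUnion fun u _ =>
    Set.finite_range u).subset fun a ⟨u, hub, i, hi⟩ => Set.mem_biUnion hub ⟨i, hi⟩
  have hS : IsDefinable L N S :=
    .ex (.and (by fun_prop (disch := assumption)) (.exFinite fun i => by fun_prop))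
  obtain ⟨e, he⟩ := hN.exists_bound hS hSfin
  have hA (a) : IsOpen {b | a ∈ A b} := by
    have : {b | a ∈ A b} = ⋃ i, interior (sliceImage R R.dom i a) := by ext; simp [A]
    exact this ▸ isOpen_iUnion fun i => isOpen_interior
  have hAfin (b) : (A b).Finite := (hSfin b).subset (hAS b)
  obtain ⟨b, -, V, hVO, hV, hbV, hAV⟩ := exists_isOpen_forall_eq_of_isOpen_setOf_mem hA hAfin
    (fun b => (Set.ncard_le_ncard (hAS b) (hSfin b)).trans (he b)) isOpen_interior
    ⟨b₀, hu.2 0 b₀ hub₀⟩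
  refine infinite_of_isOpen_pi (fun _ => hτ.infinite_of_isOpen) hV ⟨b, hbV⟩
    ((hfin.finite_image (Set.Finite.pi' fun _ => hAfin b)).subset fun b' hb' => ?_)
  obtain ⟨u', ⟨hu', -⟩, hub'⟩ := interior_subset (hVO hb')
  exact ⟨u', fun i => hAV b' hb' ▸ ⟨i, hu'.2 i b' hub'⟩, hub'⟩

theorem noDimensionDrop (hN : HasUniformFiniteness L N) (hτ : IsPreTMinimalTopology L N τ) (m : ℕ) :
    NoDimensionDrop L N m :=
  Nat.rec (noDimensionDrop_zero hτ) (fun _ ih => ih.succ hN hτ) m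

end DimensionDrop

section Pairing

open scoped SetRel

/-- The ternary relation `H` contains the graph of a map from `K × K` to `K`, is the graph of an
injective partial map into `K`, and `K` has at least two elements. -/
structure IsPairing {X : Type*} (K : Set X) (H : SetRel (X × X) X) : Prop where
  nontrivial : K.Nontrivial
  total : ∀ x ∈ K, ∀ y ∈ K, ∃ z, ((x, y), z) ∈ H
  mem : ∀ x y z, ((x, y), z) ∈ H → z ∈ K
  functional : ∀ x y z z', ((x, y), z) ∈ H → ((x, y), z') ∈ H → z = z'
  injective : ∀ x y x' y' z, ((x, y), z) ∈ H → ((x', y'), z) ∈ H → x = x' ∧ y = y'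

theorem IsPairing.isFiniteToFinite {X : Type*} {K : Set X} {H : SetRel (X × X) X}
    (h : IsPairing K H) : IsFiniteToFinite H where
  finite_right p := Set.Subsingleton.finite fun z hz z' hz' => h.functional p.1 p.2 z z' hz hz'
  finite_left z := Set.Subsingleton.finite fun p hp p' hp' =>
    Prod.ext_iff.2 (h.injective p.1 p.2 p'.1 p'.2 z hp hp')

theorem IsPairing.infinite {X : Type*} {K : Set X} {H : SetRel (X × X) X} (h : IsPairing K H) :
    K.Infinite := by
  intro hfin
  have := hfin.to_subtype
  have := h.nontrivial.coe_sort
  choose f hf using fun p : K × K => h.total p.1 p.1.2 p.2 p.2.2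
  have hinj : Function.Injective fun p => (⟨f p, h.mem _ _ _ (hf p)⟩ : K) := fun p q hpq => by
    have hfpq : f p = f q := congrArg Subtype.val hpq
    obtain ⟨h₁, h₂⟩ := h.injective _ _ _ _ _ (hf p) (hfpq ▸ hf q)
    exact Prod.ext (Subtype.ext h₁) (Subtype.ext h₂)
  have hle : Nat.card K * Nat.card K ≤ Nat.card K :=
    Nat.card_prod K K ▸ Nat.card_le_card_of_injective _ hinj
  exact hle.not_gt (lt_mul_of_one_lt_left Nat.card_pos Finite.one_lt_card)

variable {L : FirstOrder.Language.{u, v}} {N : Type w} [L.Structure N]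

theorem exists_infinite_subset_finite_coordinate_fibers {n : ℕ} (I : Finset (Fin n))
    {X : Set (Fin n → N)} (hX : IsDefinable L N X) (hinf : X.Infinite)
    (hconst : ∀ i ∉ I, ∀ x ∈ X, ∀ y ∈ X, x i = y i) :
    ∃ X' ⊆ X, IsDefinable L N X' ∧ X'.Infinite ∧ ∃ i, ∀ t, {x ∈ X' | x i = t}.Finite := by
  classical
  induction I using Finset.induction_on generalizing X with
  | empty =>
    have hsub : X.Subsingleton := fun x hx y hy =>
      funext fun i => hconst i (Finset.notMem_empty i) x hx y hy
    exact absurd hsub.finite hinf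
  | insert i I _ ih =>
    by_cases hfin : ∀ t, {x ∈ X | x i = t}.Finite
    · exact ⟨X, subset_rfl, hX, hinf, i, hfin⟩
    · push Not at hfin
      obtain ⟨t, ht⟩ := hfin
      obtain ⟨X', hX', h⟩ := ih (X := {x ∈ X | x i = t})
        (isDefinable_setOf (by fun_prop (disch := assumption))) ht fun j hj x hx y hy => by
          obtain rfl | hij := eq_or_ne j i
          · rw [hx.2, hy.2]
          · exact hconst j (by simp [hij, hj]) x hx.1 y hy.1
      exact ⟨X', fun x hx => (hX' hx).1, h⟩

theorem exists_isFiniteToFinite_infinite_dom {n : ℕ} {K : Set (Fin n → N)}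
    (hK : IsDefinable L N K) (hinf : K.Infinite) :
    ∃ E : SetRel N (Fin n → N), IsDefinable L N E ∧ IsFiniteToFinite E ∧ E.dom.Infinite ∧
      E.cod ⊆ K := by
  obtain ⟨X, hXK, hX, hXinf, i, hi⟩ :=
    exists_infinite_subset_finite_coordinate_fibers Finset.univ hK hinf (by simp)
  have hE : IsFiniteToFinite {q : N × (Fin n → N) | q.2 ∈ X ∧ q.2 i = q.1} :=
    ⟨hi, fun x => (Set.finite_singleton (x i)).subset fun t ht => ht.2.symm⟩
  refine ⟨_, isDefinable_setOf (by fun_prop (disch := assumption)), hE, fun hdom => ?_,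
    fun x ⟨_, hx, _⟩ => hXK hx⟩
  exact hXinf ((hE.finite_image hdom).subset fun x hx => ⟨x i, ⟨x, hx, rfl⟩, hx, rfl⟩)

theorem IsPairing.exists_isFiniteToFinite {Γ : Type w} [Coords N Γ] {K : Set Γ}
    {H : SetRel (Γ × Γ) Γ} (h : IsPairing K H) (hH : IsDefinable L N H) {E : SetRel N Γ}
    (hE : IsDefinable L N E) (hEfin : IsFiniteToFinite E) (hEK : E.cod ⊆ K) (k : ℕ) :
    ∃ R : SetRel (Fin k → N) Γ, IsDefinable L N R ∧ IsFiniteToFinite R ∧ R.cod ⊆ K ∧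
      ∀ u : Fin k → N, (∀ i, u i ∈ E.dom) → u ∈ R.dom := by
  induction k with
  | zero =>
    obtain ⟨c, hc⟩ := h.nontrivial.nonempty
    refine ⟨{q | q.2 = c}, isDefinable_setOf (by fun_prop), ⟨fun _ => Set.finite_singleton c,
      fun _ => Set.toFinite _⟩, ?_, fun _ _ => ⟨c, rfl⟩⟩
    rintro _ ⟨_, rfl⟩
    exact hc
  | succ k ih =>
    obtain ⟨R, hR, hRfin, hRK, hdom⟩ := ih
    have htail : Function.Injective fun u : Fin (k + 1) → N => (u 0, Fin.tail u) :=
      (Fin.consEquiv fun _ => N).symm.injective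
    refine ⟨_, ?_, ((hEfin.prodMap hRfin).comp h.isFiniteToFinite).comap_left htail, ?_, ?_⟩
    · exact isDefinable_setOf (P := fun q : (Fin (k + 1) → N) × Γ => ∃ p : Γ × Γ,
        ((q.1 0, p.1) ∈ E ∧ (Fin.tail q.1, p.2) ∈ R) ∧ (p, q.2) ∈ H)
        (by fun_prop (disch := assumption))
    · rintro z ⟨_, _, -, hz⟩
      exact h.mem _ _ _ hz
    · intro u hu
      obtain ⟨x, hx⟩ := hu 0
      obtain ⟨y, hy⟩ := hdom (Fin.tail u) fun i => hu i.succ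
      obtain ⟨z, hz⟩ := h.total x (hEK ⟨_, hx⟩) y (hRK ⟨_, hy⟩)
      exact ⟨z, (x, y), ⟨hx, hy⟩, hz⟩

theorem IsPreTMinimalTopology.not_isPairing [τ : TopologicalSpace N]
    (hN : HasUniformFiniteness L N) (hτ : IsPreTMinimalTopology L N τ) {n : ℕ}
    {K : Set (Fin n → N)} {H : SetRel ((Fin n → N) × (Fin n → N)) (Fin n → N)}
    (hK : IsDefinable L N K) (hH : IsDefinable L N H) : ¬ IsPairing K H := by
  intro h
  obtain ⟨E, hE, hEfin, hinf, hEK⟩ := exists_isFiniteToFinite_infinite_dom hK h.infinite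
  obtain ⟨R, hR, hRfin, -, hdom⟩ := h.exists_isFiniteToFinite hH hE hEfin hEK (n + 1)
  have hEdom : IsDefinable L N E.dom := isDefinable_setOf (by fun_prop (disch := assumption))
  obtain ⟨a, ha⟩ :=
    (hτ.interior_nonempty_iff _ hEdom).2 hinf
  have hcube : (Set.univ.pi fun _ : Fin (n + 1) => interior E.dom) ⊆ R.dom := fun u hu =>
    hdom u fun i => interior_subset (hu i trivial)
  have hmem : (fun _ => a) ∈ interior R.dom :=
    interior_maximal hcube (isOpen_set_pi Set.finite_univ fun _ _ => isOpen_interior)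
      fun _ _ => ha
  exact (noDimensionDrop hN hτ n R hR hRfin).subset hmem

end Pairing

section Transfer

variable {L : FirstOrder.Language.{u, v}} {α : Type w'} {n : ℕ}
variable (φ : L.Formula (α ⊕ Fin n)) (ψ : L.Formula (α ⊕ ((Fin n ⊕ Fin n) ⊕ Fin n)))

/-- The set of tuples satisfying `φ` with parameters `c`. -/
def solutionSet {S : Type w} [L.Structure S] (c : α → S) : Set (Fin n → S) :=
  {x | φ.Realize (Sum.elim c x)}

/-- The ternary relation on tuples given by `ψ` with parameters `c`. -/
def solutionRel {S : Type w} [L.Structure S] (c : α → S) :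
    SetRel ((Fin n → S) × (Fin n → S)) (Fin n → S) :=
  {q | ψ.Realize (Sum.elim c (Sum.elim (Sum.elim q.1.1 q.1.2) q.2))}

/-- The formula saying that the tuples of variables `p` and `q` are equal. -/
noncomputable def tupleEqual {V : Type*} (p q : Fin n → V) : L.Formula V :=
  Formula.iInf fun i => (Term.var (p i)).equal (Term.var (q i))

/-- The formula saying that the tuple of variables `p` belongs to the solution set of `φ` with
parameters `a`. -/
def tupleMem {V : Type*} (a : α → V) (p : Fin n → V) : L.Formula V :=
  φ.relabel (Sum.elim a p)

/-- The formula saying that the tuples of variables `p`, `q`, `r` satisfy `ψ` with parameters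
`a`. -/
def tupleRel {V : Type*} (a : α → V) (p q r : Fin n → V) : L.Formula V :=
  ψ.relabel (Sum.elim a (Sum.elim (Sum.elim p q) r))

variable {S : Type w} [L.Structure S] {φ ψ}

theorem realize_tupleEqual {V : Type*} {p q : Fin n → V} {v : V → S} :
    (tupleEqual (L := L) p q).Realize v ↔ v ∘ p = v ∘ q := by
  simp [tupleEqual, funext_iff]

theorem realize_tupleMem {V : Type*} {a : α → V} {p : Fin n → V} {v : V → S} :
    (tupleMem φ a p).Realize v ↔ v ∘ p ∈ solutionSet φ (v ∘ a) := by
  simp [tupleMem, solutionSet, Sum.comp_elim]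

theorem realize_tupleRel {V : Type*} {a : α → V} {p q r : Fin n → V} {v : V → S} :
    (tupleRel ψ a p q r).Realize v ↔ ((v ∘ p, v ∘ q), v ∘ r) ∈ solutionRel ψ (v ∘ a) := by
  simp [tupleRel, solutionRel, Sum.comp_elim]

variable (φ ψ) in
/-- The formula in the parameters saying that `φ` and `ψ` define a set and a relation that form an
`IsPairing`; its conjuncts are the fields of that structure, in order. -/
noncomputable def pairingFormula : L.Formula α :=
  let tuple (k : Fin 5) : Fin n → α ⊕ (Fin 5 × Fin n) := fun i => Sum.inr (k, i)
  let mem (k : Fin 5) := tupleMem φ Sum.inl (tuple k)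
  let rel (i j k : Fin 5) := tupleRel ψ Sum.inl (tuple i) (tuple j) (tuple k)
  let eq (i j : Fin 5) : L.Formula _ := tupleEqual (tuple i) (tuple j)
  Formula.iExs (Fin 5 × Fin n) (mem 0 ⊓ (mem 1 ⊓ ∼(eq 0 1))) ⊓
  (Formula.iAlls (Fin 5 × Fin n) (mem 0 ⟹ (mem 1 ⟹ Formula.iExs (Fin n)
    (tupleRel ψ (Sum.inl ∘ Sum.inl) (Sum.inl ∘ tuple 0) (Sum.inl ∘ tuple 1) Sum.inr))) ⊓
  (Formula.iAlls (Fin 5 × Fin n) (rel 0 1 2 ⟹ mem 2) ⊓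
  (Formula.iAlls (Fin 5 × Fin n) (rel 0 1 2 ⟹ (rel 0 1 3 ⟹ eq 2 3)) ⊓
  Formula.iAlls (Fin 5 × Fin n) (rel 0 1 4 ⟹ (rel 2 3 4 ⟹ (eq 0 2 ⊓ eq 1 3))))))

theorem realize_pairingFormula {c : α → S} :
    (pairingFormula φ ψ).Realize c ↔ IsPairing (solutionSet φ c) (solutionRel ψ c) := by
  have htuple (u : Fin 5 × Fin n → S) (k : Fin 5) :
      (Sum.elim c u ∘ fun i => Sum.inr (k, i)) = fun i => u (k, i) := rfl
  have htuple' (u : Fin 5 × Fin n → S) (x : Fin n → S) (k : Fin 5) :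
      (Sum.elim (Sum.elim c u) x ∘ Sum.inl ∘ fun i => Sum.inr (k, i)) = fun i => u (k, i) := rfl
  have hparam (u : Fin 5 × Fin n → S) (x : Fin n → S) :
      (Sum.elim (Sum.elim c u) x ∘ Sum.inl ∘ Sum.inl) = c := rfl
  simp only [pairingFormula, Formula.realize_inf, Formula.realize_iExs, Formula.realize_iAlls,
    Formula.realize_imp, Formula.realize_not, realize_tupleMem, realize_tupleRel,
    realize_tupleEqual, htuple, htuple', hparam, Sum.elim_comp_inl, Sum.elim_comp_inr]
  constructor
  · rintro ⟨⟨u, h0, h1, hne⟩, htotal, hmem, hfun, hinj⟩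
    exact
      { nontrivial := ⟨_, h0, _, h1, hne⟩
        total := fun x hx y hy => htotal (fun p => ![x, y, x, x, x] p.1 p.2) hx hy
        mem := fun x y z => hmem fun p => ![x, y, z, x, x] p.1 p.2
        functional := fun x y z z' => hfun fun p => ![x, y, z, z', x] p.1 p.2
        injective := fun x y x' y' z => hinj fun p => ![x, y, x', y', z] p.1 p.2 }
  · rintro ⟨⟨x, hx, y, hy, hne⟩, htotal, hmem, hfun, hinj⟩
    exact ⟨⟨fun p => ![x, y, x, x, x] p.1 p.2, hx, hy, hne⟩, fun _ hx hy => htotal _ hx _ hy,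
      fun _ => hmem _ _ _, fun _ => hfun _ _ _ _, fun _ => hinj _ _ _ _ _⟩

theorem exists_isPairing_of_elementarilyEquivalent [Finite α] {M : Type w'} [L.Structure M]
    (hMS : M ≅[L] S) {c : α → M} (h : IsPairing (solutionSet φ c) (solutionRel ψ c)) :
    ∃ c' : α → S, IsPairing (solutionSet φ c') (solutionRel ψ c') := by
  let θ : L.Sentence := Formula.iExs α ((pairingFormula φ ψ).relabel (Sum.inr : α → Empty ⊕ α))
  have hM : M ⊨ θ := by
    simpa [θ, Sentence.Realize, Function.comp_def] using ⟨c, realize_pairingFormula.2 h⟩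
  have hS : S ⊨ θ := (hMS.realize_sentence θ).1 hM
  obtain ⟨c', hc'⟩ : ∃ c', (pairingFormula φ ψ).Realize c' := by
    simpa [θ, Sentence.Realize, Function.comp_def] using hS
  exact ⟨c', realize_pairingFormula.1 hc'⟩

theorem isDefinable_solutionSet {c : α → S} : IsDefinable L S (solutionSet φ c) := by
  refine Set.definable_iff_exists_formula_sum.2
    ⟨φ.relabel (Sum.map (fun a => ⟨c a, trivial⟩) id), ?_⟩
  ext x
  simp only [Set.mem_ofPred_eq, Formula.realize_relabel, Sum.elim_comp_map]
  rfl

theorem isDefinable_solutionRel {c : α → S} : IsDefinable L S (solutionRel ψ c) := by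
  refine Set.definable_iff_exists_formula_sum.2
    ⟨ψ.relabel (Sum.map (fun a => ⟨c a, trivial⟩) id), ?_⟩
  ext x
  simp only [Set.mem_ofPred_eq, Formula.realize_relabel, Sum.elim_comp_map]
  refine Eq.to_iff (congrArg ψ.Realize (congrArg₂ Sum.elim rfl ?_))
  ext ((i | i) | i) <;> rfl

theorem IsDefinable.exists_eq_solutionSet_solutionRel {K : Set (Fin n → S)}
    {H : SetRel ((Fin n → S) × (Fin n → S)) (Fin n → S)} (hK : IsDefinable L S K)
    (hH : IsDefinable L S H) :
    ∃ (A : Finset S) (φ : L.Formula (A ⊕ Fin n)) (ψ : L.Formula (A ⊕ ((Fin n ⊕ Fin n) ⊕ Fin n))),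
      K = solutionSet φ (fun a => (a : S)) ∧ H = solutionRel ψ (fun a => (a : S)) := by
  classical
  obtain ⟨A₁, -, hA₁⟩ := Set.definable_iff_finitely_definable.1 hK
  obtain ⟨A₂, -, hA₂⟩ := Set.definable_iff_finitely_definable.1 hH
  obtain ⟨φ, hφ⟩ := Set.definable_iff_exists_formula_sum.1
    (hA₁.mono (B := ((A₁ ∪ A₂ : Finset S) : Set S)) (by simp))
  obtain ⟨ψ, hψ⟩ := Set.definable_iff_exists_formula_sum.1
    (hA₂.mono (B := ((A₁ ∪ A₂ : Finset S) : Set S)) (by simp))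
  refine ⟨A₁ ∪ A₂, φ, ψ, hφ, ?_⟩
  ext ⟨⟨x, y⟩, z⟩
  exact Set.ext_iff.1 hψ (Sum.elim (Sum.elim x y) z)

theorem IsPreTMinimalTopology.not_isPairing_of_elementarilyEquivalent {τ : TopologicalSpace S}
    (hS : HasUniformFiniteness L S) (hτ : IsPreTMinimalTopology L S τ) {M : Type w'} [L.Structure M]
    (hMS : M ≅[L] S) {K : Set (Fin n → M)} {H : SetRel ((Fin n → M) × (Fin n → M)) (Fin n → M)}
    (hK : IsDefinable L M K) (hH : IsDefinable L M H) : ¬ IsPairing K H := by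
  intro h
  obtain ⟨A, φ, ψ, rfl, rfl⟩ := hK.exists_eq_solutionSet_solutionRel hH
  obtain ⟨c, hc⟩ := exists_isPairing_of_elementarilyEquivalent hMS h
  exact hτ.not_isPairing hS isDefinable_solutionSet isDefinable_solutionRel hc

end Transfer

section Field

variable {L : FirstOrder.Language.{u, v}} {M : Type w} [L.Structure M] {n : ℕ}
  {K : Set (Fin n → M)}

/-- The graph of a binary operation on `K`, as a ternary relation on the ambient power of `M`. -/
def opGraph (f : K → K → K) : SetRel ((Fin n → M) × (Fin n → M)) (Fin n → M) :=
  {q | ∃ x y : K, q.1.1 = x ∧ q.1.2 = y ∧ q.2 = f x y}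

variable (L) in
/-- A binary operation on `K` whose graph is definable with parameters. -/
def IsDefinableOp (f : K → K → K) : Prop := IsDefinable L M (opGraph f)

theorem mem_opGraph {f : K → K → K} {x y : K} {z : Fin n → M} :
    (((x : Fin n → M), (y : Fin n → M)), z) ∈ opGraph f ↔ z = f x y := by
  constructor
  · rintro ⟨x', y', hx, hy, h⟩
    rwa [Subtype.ext hx, Subtype.ext hy]
  · exact fun h => ⟨x, y, rfl, rfl, h⟩

namespace IsDefinableOp

theorem of_definable_graph {f : K → K → K} (hf : (Set.univ : Set M).Definable L
    {t : Fin n ⊕ Fin n ⊕ Fin n → M | ∃ x y : K, t = Sum.elim x (Sum.elim y (f x y))}) :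
    IsDefinableOp L f := by
  have hmap : IsDefinableMap L M fun q : ((Fin n → M) × (Fin n → M)) × (Fin n → M) =>
      Sum.elim q.1.1 (Sum.elim q.1.2 q.2) := by
    refine IsDefinableMap.pi ?_
    rintro (i | i | i) <;> simp only [Sum.elim_inl, Sum.elim_inr] <;> fun_prop
  exact ((isDefinable_iff_definable.2 hf).mem hmap).congr fun q => by
    simp [opGraph, Sum.elim_eq_iff]

theorem of_isDefinableMap (hK : IsDefinable L M K) {f : K → K → K}
    {g : (Fin n → M) × (Fin n → M) → Fin n → M} (hg : IsDefinableMap L M g)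
    (hfg : ∀ x y : K, (f x y : Fin n → M) = g (x, y)) : IsDefinableOp L f := by
  refine IsDefinablePred.congr (P := fun q : ((Fin n → M) × (Fin n → M)) × (Fin n → M) =>
    q.1.1 ∈ K ∧ q.1.2 ∈ K ∧ q.2 = g q.1) (by fun_prop (disch := assumption)) fun q => ?_
  obtain ⟨⟨u, v⟩, w⟩ := q
  constructor
  · rintro ⟨x, y, rfl, rfl, rfl⟩
    exact ⟨x.2, y.2, hfg x y⟩
  · rintro ⟨hu, hv, hw⟩
    exact ⟨⟨u, hu⟩, ⟨v, hv⟩, rfl, rfl, hw.trans (hfg ⟨u, hu⟩ ⟨v, hv⟩).symm⟩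

theorem left (hK : IsDefinable L M K) : IsDefinableOp L fun x _ : K => x :=
  of_isDefinableMap hK (.fst .id) fun _ _ => rfl

theorem const (hK : IsDefinable L M K) (t : K) : IsDefinableOp L fun _ _ : K => t :=
  of_isDefinableMap hK (.const (t : Fin n → M)) fun _ _ => rfl

theorem swap {f : K → K → K} (hf : IsDefinableOp L f) : IsDefinableOp L fun x y => f y x := by
  refine (IsDefinable.mem hf (f := fun q : ((Fin n → M) × (Fin n → M)) × (Fin n → M) =>
    ((q.1.2, q.1.1), q.2)) (by fun_prop)).congr fun q => ?_
  exact exists_comm.trans (exists₂_congr fun _ _ => and_left_comm)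

theorem comp₂ {f g h : K → K → K} (hf : IsDefinableOp L f) (hg : IsDefinableOp L g)
    (hh : IsDefinableOp L h) : IsDefinableOp L fun x y => f (g x y) (h x y) := by
  unfold IsDefinableOp at hf hg hh
  refine IsDefinablePred.congr (P := fun q : ((Fin n → M) × (Fin n → M)) × (Fin n → M) =>
    ∃ a b : Fin n → M, (q.1, a) ∈ opGraph g ∧ (q.1, b) ∈ opGraph h ∧ ((a, b), q.2) ∈ opGraph f)
    (by fun_prop (disch := assumption)) fun q => ?_
  obtain ⟨⟨u, v⟩, w⟩ := q
  constructor
  · rintro ⟨x, y, rfl, rfl, rfl⟩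
    exact ⟨_, _, mem_opGraph.2 rfl, mem_opGraph.2 rfl, mem_opGraph.2 rfl⟩
  · rintro ⟨_, _, ⟨x, y, rfl, rfl, rfl⟩, hb, hw⟩
    obtain rfl := mem_opGraph.1 hb
    exact mem_opGraph.2 (mem_opGraph.1 hw)

end IsDefinableOp

theorem isPairing_opGraph [Nontrivial K] {f : K → K → K} (hf : Function.Injective2 f) :
    IsPairing K (opGraph f) where
  nontrivial := Set.nontrivial_coe_sort.1 ‹_›
  total x hx y hy := ⟨_, ⟨x, hx⟩, ⟨y, hy⟩, rfl, rfl, rfl⟩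
  mem := by
    rintro _ _ _ ⟨x, y, -, -, rfl⟩
    exact (f x y).2
  functional := by
    rintro _ _ _ z' ⟨x, y, rfl, rfl, rfl⟩ h'
    exact (mem_opGraph.1 h').symm
  injective := by
    rintro _ _ _ _ _ ⟨x, y, rfl, rfl, rfl⟩ ⟨x', y', rfl, rfl, h⟩
    exact (hf (Subtype.ext h)).imp (congrArg _) (congrArg _)

variable [Field K]

theorem IsDefinableField.isDefinableOp_pow_left (hK : IsDefinableField L K) (k : ℕ) :
    IsDefinableOp L fun x _ : K => x ^ k := by
  have hmul : IsDefinableOp L fun x y : K => x * y := .of_definable_graph hK.mul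
  induction k with
  | zero => simpa only [pow_zero] using IsDefinableOp.const hK.carrier 1
  | succ k ih => simpa only [pow_succ] using hmul.comp₂ ih (.left hK.carrier)

theorem IsDefinableField.isDefinableOp_pow_add_mul_pow (hK : IsDefinableField L K) (p : ℕ)
    (t : K) : IsDefinableOp L fun x y : K => x ^ p + t * y ^ p := by
  have hadd : IsDefinableOp L fun x y : K => x + y := .of_definable_graph hK.add
  have hmul : IsDefinableOp L fun x y : K => x * y := .of_definable_graph hK.mul
  have hpow := hK.isDefinableOp_pow_left p
  exact hadd.comp₂ hpow (hmul.comp₂ (.const hK.carrier t) hpow.swap)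

end Field

theorem injective2_pow_add_mul_pow {F : Type*} [Field F] {p : ℕ} [ExpChar F p] {t : F}
    (ht : ∀ x : F, x ^ p ≠ t) : Function.Injective2 fun x y : F => x ^ p + t * y ^ p := by
  intro x x' y y' (h : x ^ p + t * y ^ p = x' ^ p + t * y' ^ p)
  have hsub : (x - x') ^ p = t * (y' - y) ^ p := by
    rw [sub_pow_expChar, sub_pow_expChar]
    linear_combination h
  have hy : y' - y = 0 := by
    by_contra hy
    refine ht ((x - x') / (y' - y)) ?_
    rw [div_pow, hsub, mul_div_cancel_right₀ _ (pow_ne_zero _ hy)]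
  have hp : p ≠ 0 := (expChar_pos F p).ne'
  rw [hy, zero_pow hp, mul_zero, pow_eq_zero_iff hp] at hsub
  exact ⟨sub_eq_zero.1 hsub, (sub_eq_zero.1 hy).symm⟩

end TMin

theorem corollary2p37_general {L : FirstOrder.Language.{u, v}} {N : Type w} [L.Structure N]
    (hN : TMin.HasUniformFiniteness L N) {τ : TopologicalSpace N}
    (hτ : TMin.IsPreTMinimalTopology L N τ) {M : Type w'} [L.Structure M] (hMN : M ≅[L] N)
    {n : ℕ} (K : Set (Fin n → M)) [Field K] (hK : TMin.IsDefinableField L K) :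
    PerfectField K := by
  obtain ⟨p, _⟩ := ExpChar.exists K
  by_contra hperf
  have hsurj : ¬ Function.Surjective (frobenius K p) := fun h =>
    have := PerfectRing.ofSurjective K p h
    hperf (PerfectRing.toPerfectField K p)
  simp only [Function.Surjective, not_forall, not_exists] at hsurj
  obtain ⟨t, ht⟩ := hsurj
  exact hτ.not_isPairing_of_elementarilyEquivalent hN hMN hK.carrier
    (hK.isDefinableOp_pow_add_mul_pow p t)
    (TMin.isPairing_opGraph (TMin.injective2_pow_add_mul_pow ht))

theorem corollary2p37 {L : FirstOrder.Language.{u, v}} (T : L.Theory) (hT : T.IsComplete)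
    (hmin : TMin.IsTMinimal.{u, v, w} T)
    (M : Type w') [L.Structure M] [Nonempty M] [M ⊨ T]
    {n : ℕ} (K : Set (Fin n → M)) [Field K] (hK : TMin.IsDefinableField L K) :
    PerfectField K := by
  obtain ⟨N, _, _, _, ⟨κ, hκ, -, hsat, -⟩, τ, hτ⟩ := hmin
  exact corollary2p37_general (hsat.hasUniformFiniteness hκ.le) hτ.isPreTMinimalTopology
    (hT.models_elementarily_equivalent M N) K hK
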